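/- A finite dynamical system (FDS) is a function $A : S_A \to S_A$ on a finite set $S_A$; FDSs are considered up to isomorphism (a bijection of the state sets commuting with the functions). The product $AB$ of two FDSs is the FDS $(a,b) \mapsto (A(a),B(b))$ on $S_A\times S_B$; this makes the set of FDSs a commutative monoid, whose unit $C_1$ is the FDS with a single state. A dendron is an FDS with a fixpoint whose graph (with an edge between $s$ and $A(s)$ for each state $s$) is connected. A linear dendron is a dendron in which only the fixpoint may have more than one predecessor; it has $K$ rhizomes if its fixpoint has exactly $K$ predecessors other than itself. For $K\in\mathbb{N}$, let $LD_K$ be the submonoid, of the monoid of FDSs with the product, that is generated by the linear dendrons with $K$ rhizomes. Theorem. Let $K\in\mathbb{N}$. Factorisation is unique on $LD_K$: for every $P\in LD_K$ there is exactly one finite multiset of linear dendrons with $K$ rhizomes, all different from $C_1$, whose product is $P$ (the empty multiset has product $C_1$). Moreover, the linear dendrons with $K$ rhizomes different from $C_1$ are exactly the irreducible elements of the monoid $LD_K$, so that every element of $LD_K$ has a unique factorisation into irreducible elements of $LD_K$. (The condition "different from $C_1$" excludes something only for $K=0$, since $C_1$ is the only linear dendron with $0$ rhizomes.) -/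

import Mathlib

/-- A finite dynamical system (FDS): a function from a finite set into itself. -/
structure FDS where
  /-- the set of states -/
  State : Type
  /-- there are finitely many states -/
  finite : Finite State
  /-- the transition function -/
  map : State → State

namespace FDS

/-- Two systems are isomorphic if some bijection of the states commutes with the dynamics. -/
def Iso (A B : FDS) : Prop :=
  ∃ e : A.State ≃ B.State, ∀ s, e (A.map s) = B.map (e s)

/-- Isomorphism is an equivalence relation. -/
instance setoid : Setoid FDS where
  r := Iso
  iseqv :=
    { refl := fun A => ⟨Equiv.refl _, fun _ => rfl⟩
      symm := by
        rintro A B ⟨e, he⟩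
        refine ⟨e.symm, fun s => ?_⟩
        rw [Equiv.symm_apply_eq, he, Equiv.apply_symm_apply]
      trans := by
        rintro A B C ⟨e, he⟩ ⟨f, hf⟩
        refine ⟨e.trans f, fun s => ?_⟩
        simp only [Equiv.trans_apply, he, hf] }

/-- The product of two systems: both evolve in parallel. -/
def prod (A B : FDS) : FDS where
  State := A.State × B.State
  finite := by
    have := A.finite
    have := B.finite
    infer_instance
  map := fun s => (A.map s.1, B.map s.2)

/-- The system `C₁` that consists of a single fixpoint. -/
def point : FDS where
  State := Unit
  finite := inferInstance
  map := id

/-- The (undirected) graph of a system: `s` and `A s` are joined, for every state `s`. -/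
def graph (A : FDS) : SimpleGraph A.State :=
  SimpleGraph.fromRel (fun s t => A.map s = t)

/-- A dendron is a connected system with a fixpoint. -/
def IsDendron (A : FDS) : Prop :=
  A.graph.Connected ∧ ∃ r, Function.IsFixedPt A.map r

/-- A linear dendron is a dendron such that only its fixpoint may have more than one
predecessor. -/
def IsLinearDendron (A : FDS) : Prop :=
  A.IsDendron ∧
    ∀ s, ¬ Function.IsFixedPt A.map s → ∀ t u, A.map t = s → A.map u = s → t = u

/-- The fixpoint has exactly `K` predecessors other than itself; a linear dendron with this
property is said to have `K` rhizomes. -/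
def HasRhizomes (A : FDS) (K : ℕ) : Prop :=
  ∃ r, Function.IsFixedPt A.map r ∧ {t | A.map t = r ∧ t ≠ r}.ncard = K

end FDS

/-- The finite dynamical systems up to isomorphism. -/
def FDSClass : Type 1 := Quotient FDS.setoid

namespace FDSClass

/-- The isomorphism class of a system. -/
def mk (A : FDS) : FDSClass := Quotient.mk FDS.setoid A

/-- The multiplicative monoid of finite dynamical systems up to isomorphism. -/
instance commMonoid : CommMonoid FDSClass where
  mul := Quotient.map₂ FDS.prod (by
    rintro A A' ⟨e, he⟩ B B' ⟨f, hf⟩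
    refine ⟨Equiv.prodCongr e f, fun s => ?_⟩
    exact Prod.ext (he s.1) (hf s.2))
  one := mk FDS.point
  mul_assoc := by
    rintro ⟨A⟩ ⟨B⟩ ⟨C⟩
    exact Quotient.sound ⟨Equiv.prodAssoc _ _ _, fun _ => rfl⟩
  one_mul := by
    rintro ⟨A⟩
    exact Quotient.sound ⟨Equiv.punitProd _, fun _ => rfl⟩
  mul_one := by
    rintro ⟨A⟩
    exact Quotient.sound ⟨Equiv.prodPUnit _, fun _ => rfl⟩
  mul_comm := by
    rintro ⟨A⟩ ⟨B⟩
    exact Quotient.sound ⟨Equiv.prodComm _ _, fun _ => rfl⟩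

/-- The (isomorphism classes of) linear dendrons with `K` rhizomes. -/
def linearDendrons (K : ℕ) : Set FDSClass :=
  {x | ∃ A : FDS, mk A = x ∧ A.IsLinearDendron ∧ A.HasRhizomes K}

/-- The multiplicative monoid `LD_K` generated by the linear dendrons with `K` rhizomes. -/
def LD (K : ℕ) : Submonoid FDSClass := Submonoid.closure (linearDendrons K)

end FDSClass

namespace FDS

/-! Preimage counts of every order multiply under products, so their logarithms add. Attaching to
each state of `branchStates` the exponent `weight` thus gives a multiplicative invariant `branchSum`
in the group algebra of (ℝ, +), a domain in which factors cancel. For a linear dendron every such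
state other than the fixpoint has preimage counts 1, hence weight 0. Evaluated at a complex z, the
invariant is therefore exp(a z) + c, where a is a polynomial in t with coefficients log `depthCount`
and c counts the branches with more than N states (`LinearAt.expEval_branchSum`). The depth counts
determine a linear dendron (`LinearAt.iso`). Given two multisets with equal products, let N + 1 be
the least index from which all depth counts are constant, and choose t so that equal exponents force
equal depth counts up to N. Among the factors with c > 0 take one with a maximal. For N > 0 it
vanishes at z = (log c + iπ)/a. Another factor can vanish there only if it has the same a and c
(`eq_of_exp_add_eq_zero`), hence is the same dendron. So this dendron lies in both multisets
(`exists_common_mem`); cancel it and induct. For N = 0 all factors coincide, and it suffices that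
neither multiset is empty. -/

noncomputable instance (A : FDS) : Fintype A.State := @Fintype.ofFinite _ A.finite

/-- The number of states that reach `v` in exactly `n` steps. -/
noncomputable def preimageCount (A : FDS) (n : ℕ) (v : A.State) : ℕ :=
  Nat.card {u // A.map^[n] u = v}

/-- The number of states that reach a fixpoint within `n` steps. -/
noncomputable def depthCount (A : FDS) (n : ℕ) : ℕ :=
  Nat.card {u // Function.IsFixedPt A.map (A.map^[n] u)}

/-- The states one step away from a fixpoint that have an ancestor of order `N`. -/
def branchStates (A : FDS) (N : ℕ) : Set A.State :=
  {v | Function.IsFixedPt A.map (A.map v) ∧ ∃ u, A.map^[N] u = v}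

/-- A weighted sum of the logarithms of the preimage counts of order at most `N`. -/
noncomputable def weight (A : FDS) (N : ℕ) (t : ℝ) (v : A.State) : ℝ :=
  ∑ n ∈ Finset.range (N + 1), t ^ n * Real.log (A.preimageCount n v)

open Classical in
/-- The contribution of a state to `branchSum`. -/
noncomputable def branchTerm (A : FDS) (N : ℕ) (t : ℝ) (v : A.State) : AddMonoidAlgebra ℂ ℝ :=
  if v ∈ A.branchStates N then AddMonoidAlgebra.single (A.weight N t v) 1 else 0

/-- The formal exponential sum that records the weights of the states in `branchStates`. -/
noncomputable def branchSum (A : FDS) (N : ℕ) (t : ℝ) : AddMonoidAlgebra ℂ ℝ :=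
  ∑ v, A.branchTerm N t v

/-! ### Isomorphism invariance and multiplicativity of the branch sum -/

section Iso

variable {A B : FDS} (e : A.State ≃ B.State) (he : ∀ s, e (A.map s) = B.map (e s))
include he

theorem equiv_iterate (n : ℕ) (s : A.State) : e (A.map^[n] s) = B.map^[n] (e s) :=
  Function.Semiconj.iterate_right (show Function.Semiconj e A.map B.map from he) n s

theorem equiv_isFixedPt (s : A.State) :
    Function.IsFixedPt A.map s ↔ Function.IsFixedPt B.map (e s) := by
  unfold Function.IsFixedPt
  rw [← he, e.apply_eq_iff_eq]

theorem preimageCount_equiv (n : ℕ) (v : A.State) :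
    A.preimageCount n v = B.preimageCount n (e v) :=
  Nat.card_congr (e.subtypeEquiv fun u => by rw [← equiv_iterate e he, e.apply_eq_iff_eq])

theorem depthCount_equiv (n : ℕ) : A.depthCount n = B.depthCount n :=
  Nat.card_congr (e.subtypeEquiv fun u => by
    rw [← equiv_iterate e he, ← equiv_isFixedPt e he])

theorem branchSum_equiv (N : ℕ) (t : ℝ) : A.branchSum N t = B.branchSum N t := by
  refine Fintype.sum_equiv e _ _ fun v => ?_
  have h1 : v ∈ A.branchStates N ↔ e v ∈ B.branchStates N := by
    refine and_congr ?_ ?_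
    · rw [equiv_isFixedPt e he, he]
    · rw [e.surjective.exists]
      simp_rw [← equiv_iterate e he, e.apply_eq_iff_eq]
  have h2 : A.weight N t v = B.weight N t (e v) := by
    simp_rw [weight, preimageCount_equiv e he]
  unfold branchTerm
  by_cases hv : v ∈ A.branchStates N
  · rw [if_pos hv, if_pos (h1.1 hv), h2]
  · rw [if_neg hv, if_neg (mt h1.2 hv)]

end Iso

theorem prod_iterate (A B : FDS) (n : ℕ) (s : (A.prod B).State) :
    (A.prod B).map^[n] s = (A.map^[n] s.1, B.map^[n] s.2) := by
  have : (A.prod B).map = Prod.map A.map B.map := rfl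
  rw [this]
  exact congrFun (Prod.map_iterate A.map B.map n) s

theorem preimageCount_prod (A B : FDS) (n : ℕ) (v : (A.prod B).State) :
    (A.prod B).preimageCount n v = A.preimageCount n v.1 * B.preimageCount n v.2 := by
  unfold preimageCount
  rw [← Nat.card_prod]
  refine Nat.card_congr ((Equiv.subtypeEquivRight fun u => ?_).trans
    (Equiv.subtypeProdEquivProd
      (p := fun a => A.map^[n] a = v.1) (q := fun b => B.map^[n] b = v.2)))
  rw [prod_iterate]
  exact Prod.ext_iff

/-- An ancestor of order N yields one of every smaller order. Positivity is what makes the logarithm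
additive on products of counts; with the value 0 for log 0 additivity could fail. -/
theorem preimageCount_pos (A : FDS) {n N : ℕ} (h : n ≤ N) {v : A.State}
    (hv : ∃ u, A.map^[N] u = v) : 0 < A.preimageCount n v := by
  obtain ⟨u, rfl⟩ := hv
  have : Nonempty {u' // A.map^[n] u' = A.map^[N] u} :=
    ⟨A.map^[N - n] u, by rw [← Function.iterate_add_apply, Nat.add_sub_cancel' h]⟩
  exact Nat.card_pos

theorem mem_branchStates_prod (A B : FDS) (N : ℕ) (v : (A.prod B).State) :
    v ∈ (A.prod B).branchStates N ↔ v.1 ∈ A.branchStates N ∧ v.2 ∈ B.branchStates N := by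
  have h1 : Function.IsFixedPt (A.prod B).map ((A.prod B).map v) ↔
      Function.IsFixedPt A.map (A.map v.1) ∧ Function.IsFixedPt B.map (B.map v.2) :=
    Prod.ext_iff
  have h2 : (∃ u, (A.prod B).map^[N] u = v) ↔
      (∃ u, A.map^[N] u = v.1) ∧ ∃ u, B.map^[N] u = v.2 := by
    simp_rw [prod_iterate]
    constructor
    · rintro ⟨u, rfl⟩
      exact ⟨⟨_, rfl⟩, ⟨_, rfl⟩⟩
    · rintro ⟨⟨a, ha⟩, ⟨b, hb⟩⟩
      exact ⟨(a, b), Prod.ext ha hb⟩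
  simp only [branchStates, Set.mem_ofPred_eq, h1, h2]
  tauto

theorem branchTerm_prod (A B : FDS) (N : ℕ) (t : ℝ) (v : (A.prod B).State) :
    (A.prod B).branchTerm N t v = A.branchTerm N t v.1 * B.branchTerm N t v.2 := by
  unfold branchTerm
  by_cases h1 : v.1 ∈ A.branchStates N
  · by_cases h2 : v.2 ∈ B.branchStates N
    · rw [if_pos ((mem_branchStates_prod A B N v).2 ⟨h1, h2⟩), if_pos h1, if_pos h2,
        AddMonoidAlgebra.single_mul_single, mul_one]
      congr 1
      simp_rw [weight]
      rw [← Finset.sum_add_distrib]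
      refine Finset.sum_congr rfl fun n hn => ?_
      have hn' : n ≤ N := Nat.lt_succ_iff.1 (Finset.mem_range.1 hn)
      have p1 := preimageCount_pos A hn' h1.2
      have p2 := preimageCount_pos B hn' h2.2
      rw [preimageCount_prod, Nat.cast_mul, Real.log_mul (by positivity) (by positivity), mul_add]
    · rw [if_neg (fun h => h2 ((mem_branchStates_prod A B N v).1 h).2), if_neg h2, mul_zero]
  · rw [if_neg (fun h => h1 ((mem_branchStates_prod A B N v).1 h).1), if_neg h1, zero_mul]

theorem branchSum_prod (A B : FDS) (N : ℕ) (t : ℝ) :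
    (A.prod B).branchSum N t = A.branchSum N t * B.branchSum N t := by
  unfold branchSum
  rw [Finset.sum_mul_sum, ← Fintype.sum_prod_type']
  exact Fintype.sum_equiv (ι := (A.prod B).State) (κ := A.State × B.State) (Equiv.refl _) _
    (fun v => A.branchTerm N t v.1 * B.branchTerm N t v.2) fun v => branchTerm_prod A B N t v

theorem preimageCount_point (n : ℕ) (v : point.State) : point.preimageCount n v = 1 := by
  have : Subsingleton point.State := inferInstanceAs (Subsingleton Unit)
  have : Nonempty {u // point.map^[n] u = v} := ⟨v, Subsingleton.elim _ _⟩
  exact Nat.card_unique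

theorem branchSum_point (N : ℕ) (t : ℝ) : point.branchSum N t = 1 := by
  have : Subsingleton point.State := inferInstanceAs (Subsingleton Unit)
  obtain ⟨u⟩ : Nonempty point.State := ⟨()⟩
  have h : u ∈ point.branchStates N := ⟨Subsingleton.elim _ _, u, Subsingleton.elim _ _⟩
  rw [branchSum, Fintype.sum_subsingleton _ u, AddMonoidAlgebra.one_def]
  unfold branchTerm
  rw [if_pos h]
  simp [weight, preimageCount_point]

/-! ### Linear systems and their depth counts -/

/-- `A` is a system of linear branches that lead to the fixpoint `r`. -/
structure LinearAt (A : FDS) (r : A.State) : Prop where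
  fixed : Function.IsFixedPt A.map r
  reach : ∀ u, ∃ n, A.map^[n] u = r
  inj : ∀ s, s ≠ r → ∀ t u, A.map t = s → A.map u = s → t = u

theorem exists_iterate_eq_of_connected {A : FDS} (h : A.graph.Connected) {r : A.State}
    (hr : Function.IsFixedPt A.map r) (u : A.State) : ∃ n, A.map^[n] u = r := by
  obtain ⟨p⟩ := h.preconnected u r
  induction p with
  | nil => exact ⟨0, rfl⟩
  | @cons u v w hadj _ ih =>
    obtain ⟨n, hn⟩ := ih hr
    rcases ((SimpleGraph.fromRel_adj _ _ _).1 hadj).2 with h1 | h1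
    · exact ⟨n + 1, by rw [Function.iterate_succ_apply, h1, hn]⟩
    -- The edge is traversed against the dynamics: n steps from u are n + 1 steps from v, and r is
    -- fixed.
    · refine ⟨n, ?_⟩
      rw [← h1, ← Function.iterate_succ_apply, Function.iterate_succ_apply', hn, hr]

theorem linearAt_point : point.LinearAt () where
  fixed := rfl
  reach := fun _ => ⟨0, rfl⟩
  inj := fun _ h => absurd rfl h

namespace LinearAt

variable {A : FDS} {r : A.State} (h : A.LinearAt r)
include h

theorem isFixedPt_iff (s : A.State) : Function.IsFixedPt A.map s ↔ s = r := by
  constructor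
  · intro hs
    obtain ⟨n, hn⟩ := h.reach s
    rw [← hn, Function.iterate_fixed hs]
  · rintro rfl
    exact h.fixed

/-- Orbits merge only at r: if r is not reached after n steps, it was not reached earlier, and each
step can be undone uniquely. -/
theorem iterate_inj (n : ℕ) {u u' : A.State} (huu' : A.map^[n] u = A.map^[n] u')
    (hr : A.map^[n] u ≠ r) : u = u' := by
  induction n generalizing u u' with
  | zero => exact huu'
  | succ n ih =>
    rw [Function.iterate_succ_apply] at huu' hr
    rw [Function.iterate_succ_apply] at huu'
    have h1 := ih huu' hr
    refine h.inj (A.map u) (fun h2 => hr ?_) u u' rfl h1.symm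
    rw [h2, Function.iterate_fixed h.fixed]

theorem iterate_of_le {m n : ℕ} (hmn : m ≤ n) {u : A.State} (hu : A.map^[m] u = r) :
    A.map^[n] u = r := by
  rw [← Nat.sub_add_cancel hmn, Function.iterate_add_apply, hu, Function.iterate_fixed h.fixed]

theorem exists_iterate_all : ∃ N, ∀ u, A.map^[N] u = r := by
  choose f hf using h.reach
  exact ⟨Finset.univ.sup f, fun u => h.iterate_of_le (Finset.le_sup (Finset.mem_univ u)) (hf u)⟩

theorem depthCount_eq (n : ℕ) : A.depthCount n = Nat.card {u // A.map^[n] u = r} :=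
  Nat.card_congr (Equiv.subtypeEquivRight fun _ => h.isFixedPt_iff _)

theorem depthCount_pos (n : ℕ) : 0 < A.depthCount n := by
  have : Nonempty {u // A.map^[n] u = r} := ⟨r, Function.iterate_fixed h.fixed n⟩
  rw [h.depthCount_eq]
  exact Nat.card_pos

theorem depthCount_mono : Monotone A.depthCount := by
  intro m n hmn
  rw [h.depthCount_eq, h.depthCount_eq]
  exact Nat.card_le_card_of_injective
    (Subtype.map id fun u hu => h.iterate_of_le hmn hu) (Subtype.map_injective _ Function.injective_id)

theorem depthCount_zero : A.depthCount 0 = 1 := by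
  rw [h.depthCount_eq]
  exact Nat.card_unique (α := {u // u = r})

theorem exists_depthCount_const : ∃ N, ∀ n, N ≤ n → A.depthCount n = A.depthCount N := by
  obtain ⟨N, hN⟩ := h.exists_iterate_all
  refine ⟨N, fun n hn => ?_⟩
  rw [h.depthCount_eq, h.depthCount_eq]
  exact Nat.card_congr (Equiv.subtypeEquivRight fun u =>
    ⟨fun _ => hN u, fun hu => h.iterate_of_le hn hu⟩)

theorem preimageCount_eq_one {n N : ℕ} (hn : n ≤ N) {v : A.State} (hv : ∃ u, A.map^[N] u = v)
    (hvr : v ≠ r) : A.preimageCount n v = 1 := by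
  refine le_antisymm ?_ (A.preimageCount_pos hn hv)
  have : Subsingleton {u // A.map^[n] u = v} :=
    ⟨fun a b => Subtype.ext (h.iterate_inj n (a.2.trans b.2.symm) (a.2.trans_ne hvr))⟩
  exact Finite.card_le_one_iff_subsingleton.2 this

/-- The number of branches with more than `N` states. -/
theorem card_branch (N : ℕ) :
    A.depthCount (N + 1) =
      A.depthCount N + Nat.card {v // (A.map v = r ∧ v ≠ r) ∧ ∃ u, A.map^[N] u = v} := by
  have e : {u // A.map^[N + 1] u = r ∧ A.map^[N] u ≠ r} ≃
      {v // (A.map v = r ∧ v ≠ r) ∧ ∃ u, A.map^[N] u = v} :=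
    -- A state that reaches r after exactly N + 1 steps is sent to the rhizome through which it
    -- passes.
    Equiv.ofBijective
      (fun u => ⟨A.map^[N] u.1,
        ⟨(Function.iterate_succ_apply' A.map N u.1).symm.trans u.2.1, u.2.2⟩, u.1, rfl⟩)
      ⟨fun a b hab => Subtype.ext (h.iterate_inj N (Subtype.ext_iff.1 hab) a.2.2), by
        rintro ⟨_, ⟨h1, h2⟩, u, rfl⟩
        exact ⟨⟨u, by rw [Function.iterate_succ_apply']; exact h1, h2⟩, rfl⟩⟩
  rw [← Nat.card_congr e, h.depthCount_eq, h.depthCount_eq]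
  have h1 : {u | A.map^[N + 1] u = r} =
      {u | A.map^[N] u = r} ∪ {u | A.map^[N + 1] u = r ∧ A.map^[N] u ≠ r} := by
    ext u
    simp only [Set.mem_ofPred_eq, Set.mem_union]
    have := h.iterate_of_le (u := u) (Nat.le_succ N)
    tauto
  have h2 : Disjoint {u | A.map^[N] u = r} {u | A.map^[N + 1] u = r ∧ A.map^[N] u ≠ r} :=
    Set.disjoint_left.2 fun u hu hu' => hu'.2 hu
  have h3 := congrArg Set.ncard h1
  rwa [Set.ncard_union_eq h2 (Set.toFinite _) (Set.toFinite _)] at h3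

theorem depthCount_one {K : ℕ} (hK : {t | A.map t = r ∧ t ≠ r}.ncard = K) :
    A.depthCount 1 = 1 + K := by
  rw [h.card_branch 0, h.depthCount_zero, ← hK]
  congr 1
  exact Nat.card_congr (Equiv.subtypeEquivRight fun v => by simp)

end LinearAt

/-! ### Evaluation of the branch sum of a linear system -/

/-- Formal exponential sums are evaluated at complex numbers. -/
noncomputable def expEval (z : ℂ) : AddMonoidAlgebra ℂ ℝ →ₐ[ℂ] ℂ :=
  AddMonoidAlgebra.lift ℂ ℂ ℝ
    { toFun := fun x => Complex.exp ((Multiplicative.toAdd x : ℝ) * z)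
      map_one' := by simp
      map_mul' := fun x y => by simp [add_mul, Complex.exp_add] }

theorem expEval_single (z : ℂ) (x : ℝ) :
    expEval z (AddMonoidAlgebra.single x 1) = Complex.exp (x * z) := by
  simp [expEval, AddMonoidAlgebra.lift_single]

/-- For a linear system the branch sum is one exponential, from the fixpoint, plus a constant. -/
theorem LinearAt.expEval_branchSum {A : FDS} {r : A.State} (h : A.LinearAt r) (N : ℕ) (t : ℝ)
    (z : ℂ) :
    expEval z (A.branchSum N t) =
      Complex.exp ((∑ n ∈ Finset.range (N + 1), t ^ n * Real.log (A.depthCount n) : ℝ) * z) +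
        (A.depthCount (N + 1) - A.depthCount N : ℕ) := by
  classical
  have hr : r ∈ A.branchStates N :=
    ⟨by rw [h.fixed]; exact h.fixed, r, Function.iterate_fixed h.fixed N⟩
  have hmem : ∀ v, v ∈ A.branchStates N ↔ A.map v = r ∧ ∃ u, A.map^[N] u = v := fun v =>
    and_congr_left' (h.isFixedPt_iff _)
  rw [branchSum, map_sum, ← Finset.add_sum_erase _ _ (Finset.mem_univ r)]
  congr 1
  -- At the fixpoint, preimage counts are depth counts.
  · rw [branchTerm, if_pos hr, expEval_single]
    simp only [weight, h.depthCount_eq, preimageCount]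
  · rw [h.card_branch N, Nat.add_sub_cancel_left, Nat.card_eq_fintype_card, Fintype.card_subtype,
      Finset.card_filter, Nat.cast_sum, ← Finset.add_sum_erase _ _ (Finset.mem_univ r)]
    rw [if_neg (fun hh => hh.1.2 rfl), Nat.cast_zero, zero_add]
    refine Finset.sum_congr rfl fun v hv => ?_
    have hvr := Finset.ne_of_mem_erase hv
    by_cases hv' : v ∈ A.branchStates N
    · have h1 := (hmem v).1 hv'
      rw [branchTerm, if_pos hv', if_pos ⟨⟨h1.1, hvr⟩, h1.2⟩, expEval_single]
      -- All preimage counts of v are 1, so every logarithm vanishes and v contributes exp 0 = 1.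
      have : A.weight N t v = 0 := Finset.sum_eq_zero fun n hn => by
        rw [h.preimageCount_eq_one (Nat.lt_succ_iff.1 (Finset.mem_range.1 hn)) h1.2 hvr]
        simp
      simp [this]
    · rw [branchTerm, if_neg hv', if_neg (fun hh => hv' ((hmem v).2 ⟨hh.1.1, hh.2⟩)), map_zero,
        Nat.cast_zero]

end FDS

/-! ### Bijections from equal counts -/

/-- Two functions on finite types with the same superlevel counts have the same values up to a
bijection. -/
theorem exists_equiv_of_card_le {X Y : Type} [Finite X] [Finite Y] {f : X → ℕ} {g : Y → ℕ}
    (h : ∀ n, Nat.card {x // n ≤ f x} = Nat.card {y // n ≤ g y}) :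
    ∃ σ : X ≃ Y, ∀ x, g (σ x) = f x := by
  have key : ∀ {Z : Type} [Finite Z] (f : Z → ℕ) (n : ℕ),
      Nat.card {x // n ≤ f x} = Nat.card {x // f x = n} + Nat.card {x // n + 1 ≤ f x} := by
    intro Z _ f n
    have h1 : {x | n ≤ f x} = {x | f x = n} ∪ {x | n + 1 ≤ f x} := by
      ext x
      change n ≤ f x ↔ f x = n ∨ n + 1 ≤ f x
      omega
    have h2 : Disjoint {x | f x = n} {x | n + 1 ≤ f x} :=
      Set.disjoint_left.2 fun x (hx : f x = n) (hx' : n + 1 ≤ f x) => by omega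
    have h3 := congrArg Set.ncard h1
    rwa [Set.ncard_union_eq h2 (Set.toFinite _) (Set.toFinite _)] at h3
  have hfib : ∀ n, Nat.card {x // f x = n} = Nat.card {y // g y = n} := fun n => by
    have h1 := key f n
    have h2 := key g n
    have h3 := h n
    have h4 := h (n + 1)
    omega
  exact ⟨Equiv.ofFiberEquiv fun n => Classical.choice (Finite.card_eq.1 (hfib n)),
    fun x => Equiv.ofFiberEquiv_map _ x⟩

/-- Finite types with decreasing families of subsets of equal sizes are in bijection, compatibly
with the families. -/
theorem exists_equiv_of_card_eq {X Y : Type} [Finite X] [Finite Y] {P : ℕ → X → Prop}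
    {Q : ℕ → Y → Prop} (hP : ∀ n x, P (n + 1) x → P n x) (hQ : ∀ n y, Q (n + 1) y → Q n y)
    (hP0 : ∀ x, P 0 x) (hQ0 : ∀ y, Q 0 y) (hP' : ∀ x, ∃ n, ¬ P n x) (hQ' : ∀ y, ∃ n, ¬ Q n y)
    (hcard : ∀ n, Nat.card {x // P n x} = Nat.card {y // Q n y}) :
    ∃ σ : X ≃ Y, ∀ n x, P n x ↔ Q n (σ x) := by
  have key : ∀ {Z : Type} {R : ℕ → Z → Prop} (_ : ∀ n x, R (n + 1) x → R n x)
      (_ : ∀ x, ∃ n, ¬ R n x), ∃ f : Z → ℕ, ∀ n x, R n x ↔ n + 1 ≤ f x := by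
    classical
    intro Z R hR hR'
    -- For a decreasing family, the first index of failure encodes membership at all levels.
    refine ⟨fun x => Nat.find (hR' x), fun n x => ?_⟩
    rw [Nat.succ_le_iff, Nat.lt_find_iff]
    exact ⟨fun h m hm => not_not.2 (Nat.decreasingInduction' (P := fun k => R k x)
      (fun k _ _ => hR k x) hm h), fun h => not_not.1 (h n le_rfl)⟩
  obtain ⟨f, hf⟩ := key hP hP'
  obtain ⟨g, hg⟩ := key hQ hQ'
  obtain ⟨σ, hσ⟩ := exists_equiv_of_card_le (f := f) (g := g) (by
    -- The level n + 1 of f corresponds to `P n`; the extra level 0 is everything, as is `P 0`.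
    rintro (_ | n)
    · have h0 := hcard 0
      rw [Nat.card_congr (Equiv.subtypeUnivEquiv hP0),
        Nat.card_congr (Equiv.subtypeUnivEquiv hQ0)] at h0
      rw [Nat.card_congr (Equiv.subtypeUnivEquiv fun _ => Nat.zero_le _),
        Nat.card_congr (Equiv.subtypeUnivEquiv fun _ => Nat.zero_le _), h0]
    · simp_rw [← hf, ← hg, hcard])
  exact ⟨σ, fun n x => by rw [hf, hg, hσ]⟩

/-! ### Reconstruction of a linear system from its depth counts -/

namespace FDS

namespace LinearAt

variable {A : FDS} {r : A.State} (h : A.LinearAt r)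
include h

/-- Stop one step before the first arrival at r. -/
theorem exists_branch {u : A.State} (hu : u ≠ r) :
    ∃ n, A.map (A.map^[n] u) = r ∧ A.map^[n] u ≠ r := by
  classical
  have hex := h.reach u
  have hpos : Nat.find hex ≠ 0 := fun h0 => hu (by
    have := Nat.find_spec hex
    rwa [h0] at this)
  obtain ⟨n, hn⟩ := Nat.exists_eq_succ_of_ne_zero hpos
  refine ⟨n, ?_, Nat.find_min hex (by omega)⟩
  rw [← Function.iterate_succ_apply' A.map, ← hn]
  exact Nat.find_spec hex

theorem branch_unique {u : A.State} {m n : ℕ} (hm : A.map (A.map^[m] u) = r)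
    (hm' : A.map^[m] u ≠ r) (hn : A.map (A.map^[n] u) = r) (hn' : A.map^[n] u ≠ r) : m = n := by
  rw [← Function.iterate_succ_apply' A.map] at hm hn
  by_contra hne
  rcases Nat.lt_or_gt_of_ne hne with hlt | hlt
  · exact hn' (h.iterate_of_le hlt hm)
  · exact hm' (h.iterate_of_le hlt hn)

end LinearAt

/-- The states next to `r`, other than `r`. -/
abbrev Rhizome (A : FDS) (r : A.State) : Type := {v : A.State // A.map v = r ∧ v ≠ r}

/-- The states `u` and `w` are at the same height on branches that `σ` matches. -/
def Matched {A B : FDS} {r : A.State} {s : B.State} (σ : A.Rhizome r → B.Rhizome s)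
    (u : A.State) (w : B.State) : Prop :=
  (u = r ∧ w = s) ∨
    ∃ n, ∃ hn : A.map (A.map^[n] u) = r ∧ A.map^[n] u ≠ r, B.map^[n] w = (σ ⟨_, hn⟩ : B.State)

section Matched

variable {A B : FDS} {r : A.State} {s : B.State}

/-- A state is pinned down by its rhizome and its height above it. Together with `Matched.symm`,
this makes functions chosen in the two directions mutually inverse. -/
theorem Matched.right_unique {σ : A.Rhizome r → B.Rhizome s} (hA : A.LinearAt r)
    (hB : B.LinearAt s) {u : A.State} {w w' : B.State} (h : Matched σ u w)
    (h' : Matched σ u w') : w = w' := by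
  rcases h with ⟨hu, hw⟩ | ⟨n, hn, hw⟩
  · rcases h' with ⟨_, hw'⟩ | ⟨m, hm, _⟩
    · rw [hw, hw']
    · exact absurd (by rw [hu, Function.iterate_fixed hA.fixed]) hm.2
  · rcases h' with ⟨hu, _⟩ | ⟨m, hm, hw'⟩
    · exact absurd (by rw [hu, Function.iterate_fixed hA.fixed]) hn.2
    · obtain rfl := hA.branch_unique hn.1 hn.2 hm.1 hm.2
      exact hB.iterate_inj n (hw.trans hw'.symm) (by rw [hw]; exact (σ _).2.2)

theorem Matched.symm {σ : A.Rhizome r ≃ B.Rhizome s} {u : A.State} {w : B.State}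
    (h : Matched σ u w) : Matched σ.symm w u := by
  rcases h with ⟨hu, hw⟩ | ⟨n, hn, hw⟩
  · exact Or.inl ⟨hw, hu⟩
  · refine Or.inr ⟨n, by rw [hw]; exact (σ _).2, ?_⟩
    simp only [hw, Subtype.coe_eta, Equiv.symm_apply_apply]

theorem Matched.map {σ : A.Rhizome r → B.Rhizome s} (hA : A.LinearAt r)
    (hB : B.LinearAt s) {u : A.State} {w : B.State} (h : Matched σ u w) :
    Matched σ (A.map u) (B.map w) := by
  rcases h with ⟨rfl, rfl⟩ | ⟨n, hn, hw⟩
  · exact Or.inl ⟨hA.fixed, hB.fixed⟩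
  · cases n with
    | zero =>
      refine Or.inl ⟨hn.1, ?_⟩
      have : w = _ := hw
      rw [this]
      exact (σ _).2.1
    | succ n => exact Or.inr ⟨n, hn, hw⟩

theorem exists_matched {σ : A.Rhizome r → B.Rhizome s} (hA : A.LinearAt r)
    (hσ : ∀ n (x : A.Rhizome r), (∃ u, A.map^[n] u = (x : A.State)) → ∃ w, B.map^[n] w = (σ x : B.State))
    (u : A.State) : ∃ w, Matched σ u w := by
  by_cases hu : u = r
  · exact ⟨s, Or.inl ⟨hu, rfl⟩⟩
  · obtain ⟨n, hn⟩ := hA.exists_branch hu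
    obtain ⟨w, hw⟩ := hσ n ⟨_, hn⟩ ⟨u, rfl⟩
    exact ⟨w, Or.inr ⟨n, hn, hw⟩⟩

end Matched

/-- Linear systems are determined by the numbers of states of each depth. -/
theorem LinearAt.iso {A B : FDS} {r : A.State} {s : B.State} (hA : A.LinearAt r)
    (hB : B.LinearAt s) (h : ∀ n, A.depthCount n = B.depthCount n) : Iso A B := by
  have hstep : ∀ {C : FDS} {c : C.State} (n : ℕ) (x : C.Rhizome c),
      (∃ u, C.map^[n + 1] u = (x : C.State)) → ∃ u, C.map^[n] u = (x : C.State) :=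
    fun n x ⟨u, hu⟩ => ⟨_, hu⟩
  have hbdd : ∀ {C : FDS} {c : C.State} (_ : C.LinearAt c) (x : C.Rhizome c),
      ∃ n, ¬ ∃ u, C.map^[n] u = (x : C.State) := fun hC x => by
    obtain ⟨N, hN⟩ := hC.exists_iterate_all
    exact ⟨N, fun ⟨u, hu⟩ => x.2.2 (by rw [← hu, hN])⟩
  have hcard : ∀ {C : FDS} {c : C.State} (_ : C.LinearAt c) (n : ℕ),
      C.depthCount (n + 1) =
        C.depthCount n + Nat.card {x : C.Rhizome c // ∃ u, C.map^[n] u = (x : C.State)} :=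
    fun {C c} hC n => by
      rw [hC.card_branch n]
      congr 1
      exact (Nat.card_congr (Equiv.subtypeSubtypeEquivSubtypeInter
        (fun v => C.map v = c ∧ v ≠ c) (fun v => ∃ u, C.map^[n] u = v))).symm
  -- Differences of consecutive depth counts give the numbers of rhizomes with an ancestor of order
  -- n, so rhizomes can be paired with branches of equal length.
  obtain ⟨σ, hσ⟩ := exists_equiv_of_card_eq
    (P := fun n (x : A.Rhizome r) => ∃ u, A.map^[n] u = (x : A.State))
    (Q := fun n (x : B.Rhizome s) => ∃ u, B.map^[n] u = (x : B.State))
    hstep hstep (fun x => ⟨x, rfl⟩) (fun x => ⟨x, rfl⟩) (hbdd hA) (hbdd hB) (fun n => by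
      have h1 := hcard hA n
      have h2 := hcard hB n
      rw [h, h] at h1
      omega)
  choose f hf using exists_matched (σ := σ) hA fun n (x : A.Rhizome r) => (hσ n x).1
  choose g hg using exists_matched (σ := σ.symm) hB fun n (x : B.Rhizome s) hx => (hσ n (σ.symm x)).2 (by
    rwa [Equiv.apply_symm_apply])
  refine ⟨⟨f, g, fun u => ?_, fun w => ?_⟩, fun u => ?_⟩
  · exact (hg (f u)).right_unique hB hA (hf u).symm
  · exact (hf (g w)).right_unique hA hB (hg w).symm
  · exact (hf (A.map u)).right_unique hA hB ((hf u).map hA hB)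

end FDS

/-! ### The invariants on isomorphism classes -/

namespace FDSClass

open FDS

/-- The number of states that reach a fixpoint within `n` steps. -/
noncomputable def depthCount (n : ℕ) : FDSClass → ℕ :=
  Quotient.lift (fun A => A.depthCount n) fun _ _ ⟨e, he⟩ => depthCount_equiv e he n

/-- The multiplicative invariant `FDS.branchSum`. -/
noncomputable def branchSum (N : ℕ) (t : ℝ) : FDSClass →* AddMonoidAlgebra ℂ ℝ where
  toFun := Quotient.lift (fun A => A.branchSum N t) fun _ _ ⟨e, he⟩ => branchSum_equiv e he N t
  map_one' := branchSum_point N t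
  map_mul' := by
    rintro ⟨A⟩ ⟨B⟩
    exact branchSum_prod A B N t

/-- The dominant exponent in `branchSum`. -/
noncomputable def exponent (N : ℕ) (t : ℝ) (x : FDSClass) : ℝ :=
  ∑ n ∈ Finset.range (N + 1), t ^ n * Real.log (depthCount n x)

/-- The number of branches with more than `N` states. -/
noncomputable def longBranches (N : ℕ) (x : FDSClass) : ℕ :=
  depthCount (N + 1) x - depthCount N x

section LinearDendrons

variable {K : ℕ} {x : FDSClass} (hx : x ∈ linearDendrons K)
include hx

theorem exists_linearAt : ∃ (A : FDS) (r : A.State), mk A = x ∧ A.LinearAt r ∧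
    {t | A.map t = r ∧ t ≠ r}.ncard = K := by
  obtain ⟨A, rfl, ⟨⟨hconn, -⟩, hinj⟩, r, hr, hK⟩ := hx
  have hreach := exists_iterate_eq_of_connected hconn hr
  refine ⟨A, r, rfl, ⟨hr, hreach, fun s hs t u ht hu => hinj s (fun hs' => hs ?_) t u ht hu⟩, hK⟩
  obtain ⟨n, hn⟩ := hreach s
  rw [← hn, Function.iterate_fixed hs']

theorem depthCount_zero : depthCount 0 x = 1 := by
  obtain ⟨A, r, rfl, h, -⟩ := exists_linearAt hx
  exact h.depthCount_zero

theorem depthCount_one : depthCount 1 x = 1 + K := by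
  obtain ⟨A, r, rfl, h, hK⟩ := exists_linearAt hx
  exact h.depthCount_one hK

theorem depthCount_pos (n : ℕ) : 0 < depthCount n x := by
  obtain ⟨A, r, rfl, h, -⟩ := exists_linearAt hx
  exact h.depthCount_pos n

theorem depthCount_mono {m n : ℕ} (hmn : m ≤ n) : depthCount m x ≤ depthCount n x := by
  obtain ⟨A, r, rfl, h, -⟩ := exists_linearAt hx
  exact h.depthCount_mono hmn

theorem depthCount_succ_le (n : ℕ) : depthCount (n + 1) x ≤ depthCount n x + K := by
  obtain ⟨A, r, rfl, h, hK⟩ := exists_linearAt hx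
  change A.depthCount (n + 1) ≤ A.depthCount n + K
  rw [h.card_branch n, ← hK]
  exact Nat.add_le_add_left (Set.ncard_le_ncard
    (s := {v | (A.map v = r ∧ v ≠ r) ∧ ∃ u, A.map^[n] u = v})
    (fun v hv => hv.1) (Set.toFinite _)) _

theorem exists_depthCount_const : ∃ N, ∀ n, N ≤ n → depthCount n x = depthCount N x := by
  obtain ⟨A, r, rfl, h, -⟩ := exists_linearAt hx
  exact h.exists_depthCount_const

theorem eq_of_depthCount_eq {L : ℕ} {y : FDSClass} (hy : y ∈ linearDendrons L)
    (h : ∀ n, depthCount n x = depthCount n y) : x = y := by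
  obtain ⟨A, r, rfl, hA, -⟩ := exists_linearAt hx
  obtain ⟨B, s, rfl, hB, -⟩ := exists_linearAt hy
  exact Quotient.sound (hA.iso hB h)

theorem eq_one_of_depthCount_eq (h : ∀ n, depthCount n x = 1) : x = 1 := by
  obtain ⟨A, r, rfl, hA, -⟩ := exists_linearAt hx
  refine Quotient.sound (hA.iso linearAt_point fun n => (h n).trans ?_)
  exact (Nat.card_unique (α := {u : Unit // (id : Unit → Unit)^[n] u = ()})).symm.trans
    (linearAt_point.depthCount_eq n).symm

theorem expEval_branchSum (N : ℕ) (t : ℝ) (z : ℂ) :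
    expEval z (branchSum N t x) = Complex.exp (exponent N t x * z) + longBranches N x := by
  obtain ⟨A, r, rfl, h, -⟩ := exists_linearAt hx
  exact h.expEval_branchSum N t z

/-- At z = 0 the value is 1 plus a natural number. This permits cancellation of a common factor. -/
theorem branchSum_ne_zero (N : ℕ) (t : ℝ) : branchSum N t x ≠ 0 := by
  intro h
  have := expEval_branchSum hx N t 0
  rw [h, map_zero, mul_zero, Complex.exp_zero] at this
  norm_cast at this
  omega

/-- The term n = 1 is already t log(1 + K) > 0; the condition on N ensures that it occurs. -/
theorem exponent_pos {N : ℕ} (hN : 1 ≤ N) {t : ℝ} (ht : 0 < t) (hK : 0 < K) :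
    0 < exponent N t x := by
  refine Finset.sum_pos' (fun n _ => mul_nonneg (by positivity) (Real.log_natCast_nonneg _))
    ⟨1, Finset.mem_range.2 (by omega), mul_pos (by positivity) (Real.log_pos ?_)⟩
  rw [depthCount_one hx]
  exact_mod_cast (by omega : 1 < 1 + K)

end LinearDendrons

/-! ### Zeros of the exponential sums and a common factor -/

/-- If `exp (a z) + c` vanishes at the first zero of `exp (b z) + d` in the upper half plane and
`a ≤ b`, then `a = b` and `c = d`. -/
theorem eq_of_exp_add_eq_zero {a b c d : ℝ} (ha : 0 < a) (hab : a ≤ b) (hd : 0 < d)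
    (h : Complex.exp (a * ((Real.log d + Real.pi * Complex.I) / b)) + c = 0) : a = b ∧ c = d := by
  have hb : 0 < b := ha.trans_le hab
  have hb' : (b : ℂ) ≠ 0 := by exact_mod_cast hb.ne'
  have h1 : (a : ℂ) * ((Real.log d + Real.pi * Complex.I) / b) =
      ((a / b * Real.log d : ℝ) : ℂ) + ((a / b * Real.pi : ℝ) : ℂ) * Complex.I := by
    push_cast
    field_simp
  have him := congrArg Complex.im h
  rw [h1, Complex.add_im, Complex.exp_im] at him
  simp only [Complex.add_re, Complex.add_im, Complex.ofReal_re, Complex.ofReal_im,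
    Complex.re_ofReal_mul, Complex.im_ofReal_mul, Complex.I_re, Complex.I_im, mul_zero, mul_one,
    add_zero, zero_add, Complex.zero_im, mul_eq_zero, Real.exp_ne_zero, false_or] at him
  have hle : a / b ≤ 1 := (div_le_one hb).2 hab
  have hpos : 0 < a / b := div_pos ha hb
  -- The exponential must be real, so sin(π a/b) = 0 with 0 < a/b ≤ 1, which leaves only a/b = 1.
  have hab' : a = b := by
    by_contra hne
    have hlt : a / b < 1 := (div_lt_one hb).2 (lt_of_le_of_ne hab hne)
    exact (Real.sin_pos_of_pos_of_lt_pi (mul_pos hpos Real.pi_pos)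
      (by nlinarith [Real.pi_pos])).ne' him
  subst hab'
  refine ⟨rfl, ?_⟩
  rw [mul_div_cancel₀ _ hb', Complex.exp_add, Complex.exp_pi_mul_I, ← Complex.ofReal_exp,
    Real.exp_log hd] at h
  have h2 : ((c : ℝ) : ℂ) = d := by linear_combination h
  exact_mod_cast h2

/-- Some base of the weights separates finitely many linear dendrons. -/
theorem exists_separating_base {K : ℕ} (S : Finset FDSClass) (hS : ∀ x ∈ S, x ∈ linearDendrons K)
    (N : ℕ) : ∃ t : ℝ, 0 < t ∧ ∀ x ∈ S, ∀ y ∈ S, exponent N t x = exponent N t y →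
      ∀ n ≤ N, depthCount n x = depthCount n y := by
  classical
  let p : FDSClass → Polynomial ℝ := fun x =>
    ∑ n ∈ Finset.range (N + 1), Polynomial.monomial n (Real.log (depthCount n x))
  have hp : ∀ t x, (p x).eval t = exponent N t x := fun t x => by
    simp [p, exponent, Polynomial.eval_finsetSum, mul_comm]
  -- The exponents are polynomials in t; any positive t outside the roots of their finitely many
  -- nonzero differences will do.
  obtain ⟨t, ht, hroot⟩ := (Set.Ioi_infinite (0 : ℝ)).exists_notMem_finset
    ((S ×ˢ S).biUnion fun q => (p q.1 - p q.2).roots.toFinset)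
  refine ⟨t, ht, fun x hx y hy hxy n hn => ?_⟩
  have hpp : p x = p y := by
    by_contra hne
    refine hroot (Finset.mem_biUnion.2 ⟨(x, y), Finset.mem_product.2 ⟨hx, hy⟩, ?_⟩)
    rw [Multiset.mem_toFinset, Polynomial.mem_roots (sub_ne_zero.2 hne), Polynomial.IsRoot.def,
      Polynomial.eval_sub, hp, hp, hxy, sub_self]
  have hcoeff : ∀ z, (p z).coeff n = Real.log (depthCount n z) := fun z => by
    simp [p, Polynomial.finsetSum_coeff, Polynomial.coeff_monomial, hn]
  have hlog := congrArg (fun q => Polynomial.coeff q n) hpp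
  simp only [hcoeff] at hlog
  have hx' := depthCount_pos (hS x hx) n
  have hy' := depthCount_pos (hS y hy) n
  exact_mod_cast Real.log_injOn_pos (Set.mem_Ioi.2 (by exact_mod_cast hx'))
    (Set.mem_Ioi.2 (by exact_mod_cast hy')) hlog

/-- Two multisets of nontrivial linear dendrons with the same invariants are disjoint only if both
are empty. -/
theorem exists_common_mem {K : ℕ} {F G : Multiset FDSClass}
    (hFG : ∀ x ∈ F + G, x ∈ linearDendrons K ∧ x ≠ 1)
    (h : ∀ N t, (F.map (branchSum N t)).prod = (G.map (branchSum N t)).prod)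
    (hne : F + G ≠ 0) : ∃ x ∈ F, x ∈ G := by
  classical
  have hLD : ∀ x ∈ F + G, x ∈ linearDendrons K := fun x hx => (hFG x hx).1
  have hex : ∃ L, ∀ x ∈ F + G, ∀ n, L ≤ n → depthCount n x = depthCount L x := by
    have := fun x : {x // x ∈ (F + G).toFinset} =>
      exists_depthCount_const (hLD x (Multiset.mem_toFinset.1 x.2))
    choose f hf using this
    refine ⟨Finset.univ.sup f, fun x hx n hn => ?_⟩
    have hle : f ⟨x, Multiset.mem_toFinset.2 hx⟩ ≤ Finset.univ.sup f :=
      Finset.le_sup (Finset.mem_univ _)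
    rw [hf ⟨x, Multiset.mem_toFinset.2 hx⟩ n (hle.trans hn), hf ⟨x, _⟩ _ hle]
  have hL0 : Nat.find hex ≠ 0 := fun h0 => by
    obtain ⟨x, hx⟩ := Multiset.exists_mem_of_ne_zero hne
    refine (hFG x hx).2 (eq_one_of_depthCount_eq (hLD x hx) fun n => ?_)
    have := Nat.find_spec hex x hx n (by omega)
    rw [this, h0, depthCount_zero (hLD x hx)]
  -- By minimality some factor still grows from depth N to N + 1, so it has a branch with more than
  -- N states.
  obtain ⟨N, hN⟩ : ∃ N, Nat.find hex = N + 1 := Nat.exists_eq_succ_of_ne_zero hL0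
  have hconst := Nat.find_spec hex
  have hmin := Nat.find_min hex (m := N) (by omega)
  rw [hN] at hconst
  have hext : ∀ x ∈ F + G, ∀ y ∈ F + G, (∀ n ≤ N + 1, depthCount n x = depthCount n y) → x = y :=
    fun x hx y hy hxy => eq_of_depthCount_eq (hLD x hx) (hLD y hy) fun n => by
      rcases le_total n (N + 1) with hn | hn
      · exact hxy n hn
      · rw [hconst x hx n hn, hconst y hy n hn, hxy _ le_rfl]
  push Not at hmin
  obtain ⟨x₁, hx₁, n₁, hn₁, hne₁⟩ := hmin
  have hlong : 0 < longBranches N x₁ := by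
    have hn : N + 1 ≤ n₁ := Nat.succ_le_of_lt (lt_of_le_of_ne hn₁ (by rintro rfl; exact hne₁ rfl))
    rw [hconst x₁ hx₁ n₁ hn] at hne₁
    have := depthCount_mono (hLD x₁ hx₁) (Nat.le_add_right N 1)
    unfold longBranches
    omega
  have hK : 0 < K := by
    have := depthCount_succ_le (hLD x₁ hx₁) N
    unfold longBranches at hlong
    omega
  have heval : ∀ t z, (F.map fun x => Complex.exp (exponent N t x * z) + longBranches N x).prod =
      (G.map fun x => Complex.exp (exponent N t x * z) + longBranches N x).prod := fun t z => by
    have h1 := congrArg (expEval z) (h N t)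
    rw [map_multiset_prod, map_multiset_prod, Multiset.map_map, Multiset.map_map] at h1
    rw [← Multiset.map_congr rfl fun x hx =>
        expEval_branchSum (hLD x (Multiset.mem_add.2 (Or.inl hx))) N t z,
      ← Multiset.map_congr rfl fun x hx =>
        expEval_branchSum (hLD x (Multiset.mem_add.2 (Or.inr hx))) N t z]
    exact h1
  -- For N = 0 all exponents are 0 and the zeros are of no use. But then depth counts 0 and 1, which
  -- are 1 and 1 + K, already determine every factor.
  rcases Nat.eq_zero_or_pos N with rfl | hNpos
  · have hcard : (F.map fun x => 1 + longBranches 0 x).prod =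
        (G.map fun x => 1 + longBranches 0 x).prod := by
      have h1 := heval 1 0
      simp only [mul_zero, Complex.exp_zero] at h1
      have h2 : ∀ H : Multiset FDSClass, (H.map fun x => (1 : ℂ) + longBranches 0 x).prod =
          ((H.map fun x => 1 + longBranches 0 x).prod : ℕ) := fun H => by
        rw [Nat.cast_multiset_prod, Multiset.map_map]
        simp
      rw [h2, h2] at h1
      exact_mod_cast h1
    have hempty : ∀ H : Multiset FDSClass, (H.map fun x => 1 + longBranches 0 x).prod = 1 →
        x₁ ∉ H := fun H hH hx => by
      have := Nat.dvd_one.1 (hH ▸ Multiset.dvd_prod (Multiset.mem_map_of_mem _ hx))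
      omega
    have hF : F ≠ 0 := by
      rintro rfl
      rw [Multiset.map_zero, Multiset.prod_zero] at hcard
      exact hempty G hcard.symm (by simpa using hx₁)
    have hG : G ≠ 0 := by
      rintro rfl
      rw [Multiset.map_zero, Multiset.prod_zero] at hcard
      exact hempty F hcard (by simpa using hx₁)
    obtain ⟨x, hx⟩ := Multiset.exists_mem_of_ne_zero hF
    obtain ⟨y, hy⟩ := Multiset.exists_mem_of_ne_zero hG
    have hx' : x ∈ F + G := Multiset.mem_add.2 (Or.inl hx)
    have hy' : y ∈ F + G := Multiset.mem_add.2 (Or.inr hy)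
    refine ⟨x, hx, ?_⟩
    rwa [hext x hx' y hy' fun n hn => ?_]
    rcases Nat.le_one_iff_eq_zero_or_eq_one.1 hn with rfl | rfl
    · rw [depthCount_zero (hLD x hx'), depthCount_zero (hLD y hy')]
    · rw [depthCount_one (hLD x hx'), depthCount_one (hLD y hy')]
  · obtain ⟨t, ht, hsep⟩ := exists_separating_base (F + G).toFinset
      (fun x hx => hLD x (Multiset.mem_toFinset.1 hx)) N
    obtain ⟨x, hx, hmax⟩ := Finset.exists_max_image
      ((F + G).toFinset.filter fun x => 0 < longBranches N x) (exponent N t)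
      ⟨x₁, Finset.mem_filter.2 ⟨Multiset.mem_toFinset.2 hx₁, hlong⟩⟩
    rw [Finset.mem_filter, Multiset.mem_toFinset] at hx
    obtain ⟨hx, hxl⟩ := hx
    have hxpos := exponent_pos (hLD x hx) hNpos ht hK
    have hxne : (exponent N t x : ℂ) ≠ 0 := by exact_mod_cast hxpos.ne'
    have hxl' : (0 : ℝ) < longBranches N x := by exact_mod_cast hxl
    set z : ℂ := (Real.log (longBranches N x) + Real.pi * Complex.I) / exponent N t x with hz
    have hzero : Complex.exp (exponent N t x * z) + longBranches N x = 0 := by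
      rw [hz, mul_div_cancel₀ _ hxne, Complex.exp_add, Complex.exp_pi_mul_I, ← Complex.ofReal_exp,
        Real.exp_log hxl']
      simp
    have huniq : ∀ y ∈ F + G, Complex.exp (exponent N t y * z) + longBranches N y = 0 →
        y = x := fun y hy hy0 => by
      -- With constant term 0 the factor is a bare exponential and never vanishes, so y falls under
      -- the maximality of x.
      have hyl : 0 < longBranches N y := Nat.pos_of_ne_zero fun h0 => by
        rw [h0, Nat.cast_zero, add_zero] at hy0
        exact Complex.exp_ne_zero _ hy0
      obtain ⟨h1, h2⟩ := eq_of_exp_add_eq_zero (c := longBranches N y)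
        (exponent_pos (hLD y hy) hNpos ht hK)
        (hmax y (Finset.mem_filter.2 ⟨Multiset.mem_toFinset.2 hy, hyl⟩)) hxl'
        (by rw [← Complex.ofReal_natCast, hz] at hy0; exact hy0)
      have h3 := hsep y (Multiset.mem_toFinset.2 hy) x (Multiset.mem_toFinset.2 hx) h1
      refine hext y hy x hx fun n hn => ?_
      rcases Nat.le_add_one_iff.1 hn with hn | rfl
      · exact h3 n hn
      -- The constant terms supply the one depth count, at N + 1, that the exponents miss.
      -- Monotonicity is needed because subtraction is truncated.
      · have h4 : longBranches N y = longBranches N x := by exact_mod_cast h2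
        have h5 := h3 N le_rfl
        have h6 := depthCount_mono (hLD x hx) (Nat.le_add_right N 1)
        have h7 := depthCount_mono (hLD y hy) (Nat.le_add_right N 1)
        unfold longBranches at h4
        omega
    have hmem : ∀ H : Multiset FDSClass, (∀ y ∈ H, y ∈ F + G) →
        ((H.map fun x => Complex.exp (exponent N t x * z) + longBranches N x).prod = 0 ↔
          x ∈ H) := fun H hH => by
      rw [Multiset.prod_eq_zero_iff, Multiset.mem_map]
      exact ⟨fun ⟨y, hy, hy0⟩ => huniq y (hH y hy) hy0 ▸ hy, fun hxH => ⟨x, hxH, hzero⟩⟩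
    have hF := hmem F fun y hy => Multiset.mem_add.2 (Or.inl hy)
    have hG := hmem G fun y hy => Multiset.mem_add.2 (Or.inr hy)
    rw [heval t z] at hF
    have hiff := hF.symm.trans hG
    have : x ∈ F := by
      rcases Multiset.mem_add.1 hx with hx | hx
      · exact hx
      · exact hiff.2 hx
    exact ⟨x, this, hiff.1 this⟩

/-! ### Unique factorisation and irreducible elements -/

theorem eq_of_branchSum_prod_eq {K : ℕ} (F G : Multiset FDSClass)
    (hF : ∀ x ∈ F, x ∈ linearDendrons K ∧ x ≠ 1) (hG : ∀ x ∈ G, x ∈ linearDendrons K ∧ x ≠ 1)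
    (h : ∀ N t, (F.map (branchSum N t)).prod = (G.map (branchSum N t)).prod) : F = G := by
  induction hn : Multiset.card F generalizing F G with
  | zero =>
    by_contra hne
    have hFG : F + G ≠ 0 := fun h0 => hne (by
      rw [(add_eq_zero.1 h0).1, (add_eq_zero.1 h0).2])
    obtain ⟨x, hx, -⟩ := exists_common_mem
      (fun x hx => (Multiset.mem_add.1 hx).elim (hF x) (hG x)) h hFG
    rw [Multiset.card_eq_zero.1 hn] at hx
    exact Multiset.notMem_zero x hx
  | succ n ih =>
    have hFG : F + G ≠ 0 := fun h0 => by
      rw [(add_eq_zero.1 h0).1] at hn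
      simp at hn
    obtain ⟨x, hx, hx'⟩ := exists_common_mem
      (fun x hx => (Multiset.mem_add.1 hx).elim (hF x) (hG x)) h hFG
    obtain ⟨F, rfl⟩ := Multiset.exists_cons_of_mem hx
    obtain ⟨G, rfl⟩ := Multiset.exists_cons_of_mem hx'
    rw [Multiset.card_cons, Nat.add_right_cancel_iff] at hn
    congr 1
    refine ih F G (fun y hy => hF y (Multiset.mem_cons_of_mem hy))
      (fun y hy => hG y (Multiset.mem_cons_of_mem hy)) (fun N t => ?_) hn
    have h1 := h N t
    rw [Multiset.map_cons, Multiset.map_cons, Multiset.prod_cons, Multiset.prod_cons] at h1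
    exact mul_left_cancel₀ (branchSum_ne_zero (hF x (Multiset.mem_cons_self _ _)).1 N t) h1

theorem factorization_unique {K : ℕ} {F G : Multiset FDSClass}
    (hF : ∀ x ∈ F, x ∈ linearDendrons K ∧ x ≠ 1) (hG : ∀ x ∈ G, x ∈ linearDendrons K ∧ x ≠ 1)
    (h : F.prod = G.prod) : F = G :=
  eq_of_branchSum_prod_eq F G hF hG fun N t => by
    rw [← map_multiset_prod, ← map_multiset_prod, h]

theorem exists_factorization {K : ℕ} {P : FDSClass} (hP : P ∈ LD K) :
    ∃ F : Multiset FDSClass, (∀ x ∈ F, x ∈ linearDendrons K ∧ x ≠ 1) ∧ F.prod = P := by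
  classical
  obtain ⟨F, hF, rfl⟩ := Submonoid.exists_multiset_of_mem_closure hP
  refine ⟨F.filter (· ≠ 1), fun x hx => ⟨hF x (Multiset.mem_filter.1 hx).1,
    (Multiset.mem_filter.1 hx).2⟩, ?_⟩
  rw [← Multiset.prod_filter_mul_prod_filter_not (s := F) (fun x => x ≠ 1)]
  have : (F.filter fun x => ¬ x ≠ 1).prod = 1 := Multiset.prod_eq_one fun x hx =>
    not_not.1 (Multiset.mem_filter.1 hx).2
  rw [this, mul_one]

/-- The joint factorisation of P and Q must be the empty factorisation of 1. -/
theorem eq_one_of_mul_eq_one {K : ℕ} {P Q : FDSClass} (hP : P ∈ LD K) (hQ : Q ∈ LD K)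
    (h : P * Q = 1) : P = 1 := by
  obtain ⟨F, hF, rfl⟩ := exists_factorization hP
  obtain ⟨G, hG, rfl⟩ := exists_factorization hQ
  have : F + G = 0 := factorization_unique
    (fun x hx => (Multiset.mem_add.1 hx).elim (hF x) (hG x)) (by simp) (by simpa using h)
  rw [(add_eq_zero.1 this).1, Multiset.prod_zero]

theorem isUnit_iff {K : ℕ} (A : LD K) : IsUnit A ↔ A = 1 := by
  refine ⟨fun h => ?_, fun h => h ▸ isUnit_one⟩
  obtain ⟨B, hB⟩ := h.exists_right_inv
  exact Subtype.ext (eq_one_of_mul_eq_one A.2 B.2 (congrArg Subtype.val hB))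

theorem irreducible_iff_mem_linearDendrons {K : ℕ} (A : LD K) :
    Irreducible A ↔ (A : FDSClass) ∈ linearDendrons K ∧ A ≠ 1 := by
  constructor
  · intro hA
    have hA1 : A ≠ 1 := fun h => hA.not_isUnit ((isUnit_iff A).2 h)
    refine ⟨?_, hA1⟩
    obtain ⟨F, hF, hFA⟩ := exists_factorization A.2
    rcases F.empty_or_exists_mem with rfl | ⟨x, hx⟩
    · exact absurd (Subtype.ext hFA.symm) hA1
    · obtain ⟨G, rfl⟩ := Multiset.exists_cons_of_mem hx
      have hxK := hF x hx
      have hGK : G.prod ∈ LD K := Submonoid.multiset_prod_mem _ _ fun y hy =>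
        Submonoid.subset_closure (hF y (Multiset.mem_cons_of_mem hy)).1
      rw [Multiset.prod_cons] at hFA
      rcases hA.isUnit_or_isUnit (a := ⟨x, Submonoid.subset_closure hxK.1⟩) (b := ⟨G.prod, hGK⟩)
        (Subtype.ext hFA.symm) with h | h
      · exact absurd (congrArg Subtype.val ((isUnit_iff _).1 h)) hxK.2
      · have h1 : G.prod = 1 := congrArg Subtype.val ((isUnit_iff _).1 h)
        rw [← hFA, h1, mul_one]
        exact hxK.1
  · rintro ⟨hA, hA1⟩
    have hA1' : (A : FDSClass) ≠ 1 := fun h => hA1 (Subtype.ext h)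
    refine ⟨fun h => hA1 ((isUnit_iff A).1 h), fun B C hBC => ?_⟩
    obtain ⟨F, hF, hFB⟩ := exists_factorization B.2
    obtain ⟨G, hG, hGC⟩ := exists_factorization C.2
    -- The factorisations of B and C together form a single factor, so one of them is empty and its
    -- product is a unit.
    have hsum : F + G = {(A : FDSClass)} := factorization_unique
      (fun x hx => (Multiset.mem_add.1 hx).elim (hF x) (hG x))
      (fun x hx => by rw [Multiset.mem_singleton.1 hx]; exact ⟨hA, hA1'⟩)
      (by rw [Multiset.prod_add, Multiset.prod_singleton, hFB, hGC, hBC]; rfl)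
    have hcard := congrArg Multiset.card hsum
    rw [Multiset.card_add, Multiset.card_singleton] at hcard
    rw [isUnit_iff, isUnit_iff]
    rcases Nat.eq_zero_or_pos (Multiset.card F) with h0 | h0
    · left
      rw [Multiset.card_eq_zero.1 h0] at hFB
      exact Subtype.ext hFB.symm
    · right
      rw [Multiset.card_eq_zero.1 (by omega : Multiset.card G = 0)] at hGC
      exact Subtype.ext hGC.symm

end FDSClass

/-- Every element of `LD_K` is, in exactly one way up to the order of the factors, a product of
linear dendrons with `K` rhizomes, and these are exactly the irreducible elements of `LD_K`.
(The unit `C₁`, which is one of these linear dendrons only for `K = 0`, is not used as a factor.) -/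
theorem mainTheorem7 (K : ℕ) :
    (∀ P ∈ FDSClass.LD K, ∃! F : Multiset FDSClass,
      (∀ A ∈ F, A ∈ FDSClass.linearDendrons K ∧ A ≠ 1) ∧ F.prod = P) ∧
    (∀ A : FDSClass.LD K,
      Irreducible A ↔ (A : FDSClass) ∈ FDSClass.linearDendrons K ∧ A ≠ 1) := by
  refine ⟨fun P hP => ?_, FDSClass.irreducible_iff_mem_linearDendrons⟩
  obtain ⟨F, hF, hFP⟩ := FDSClass.exists_factorization hP
  exact ⟨F, ⟨hF, hFP⟩, fun G hG =>
    FDSClass.factorization_unique hG.1 hF (hG.2.trans hFP.symm)⟩
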